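/- Let $G$ be a finite connected graph (loops and multiple edges allowed) with $m$ edges, vertex set $V(G)$ and set $D(G)$ of $2m$ arcs (each edge gives two mutually inverse distinct arcs $e, e^{-1}$); write $o(e), t(e)$ for the origin and terminus of $e$. Let $H=(H_{uv})_{u,v\in V(G)}$ be a Hermitian matrix with arbitrary real diagonal entries $H_{uu}$ and, for $u\ne v$, $H_{uv}=h_f e^{2i\gamma_f}$ if $f\in D(G)$ is the arc from $u$ to $v$ (the sum of these numbers over all such $f$ if there are several) and $H_{uv}=0$ if there is none, where $h_f=h_{f^{-1}}\ge 0$ and $\gamma_f=-\gamma_{f^{-1}}\in[-\pi/2,\pi/2]$ for every arc $f$. Put $\Gamma_u=\sum_{o(f)=u}h_f$, and let $\lambda\in\mathbb C$ be such that $H_{uu}-\lambda-i\Gamma_u\neq 0$ for all $u\in V(G)$. The bond scattering matrix $U(\lambda)=(U_{ef})_{e,f\in D(G)}$ is given by $$U_{ef}=\sigma^{(t(e))}_{ef}\ \text{ if } t(e)=o(f),\qquad U_{ef}=0\ \text{ otherwise},\qquad \sigma^{(u)}_{ef}=i\,\delta_{e^{-1}f}-2\,\frac{\sqrt{h_e}\sqrt{h_f}}{H_{uu}-\lambda-i\Gamma_u}\,e^{i(\gamma_e+\gamma_f)}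 .$$ Let $\Gamma$ be a finite group of order $p$ and $\alpha:D(G)\to\Gamma$ an ordinary voltage assignment, i.e. $\alpha(e^{-1})=\alpha(e)^{-1}$ for all $e$. The $\Gamma$-covering $G^\alpha$ has vertex set $V(G)\times\Gamma$ and arcs $e_g=(e,g)$, $e\in D(G)$, $g\in\Gamma$, where $e_g$ goes from $(o(e),g)$ to $(t(e),g\alpha(e))$ and $(e_g)^{-1}=(e^{-1})_{g\alpha(e)}$. Let $\tilde U(\lambda)$ be the bond scattering matrix of $G^\alpha$ for the induced data $\tilde h_{e_g}=h_e$, $\tilde\gamma_{e_g}=\gamma_e$, $\tilde H_{(u,g)(u,g)}=H_{uu}$. For $g\in\Gamma$ let $U_g=(U^{(g)}_{ef})_{e,f\in D(G)}$ with $U^{(g)}_{ef}=\sigma^{(t(e))}_{ef}$ if $t(e)=o(f)$ and $\alpha(e)=g$, and $U^{(g)}_{ef}=0$ otherwise. For a complex matrix representation $\rho$ of $\Gamma$ of degree $\deg\rho$ define the $L$-function $$Z_H(G,\lambda,\rho,\alpha)=\det\Bigl(I_{2m\deg\rho}-\sum_{g\in\Gamma}\rho(g)\otimes U_g\Bigr)^{-1}.$$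 Then $$\det\bigl(I_{2mp}-\tilde U(\lambda)\bigr)=\prod_\rho Z_H(G,\lambda,\rho,\alpha)^{-\deg\rho},$$ where $\rho$ runs over a complete list of pairwise inequivalent irreducible complex representations of $\Gamma$ (and where $Z_H(G,\lambda,\rho,\alpha)^{-\deg\rho}$ is read as $0$ if the determinant defining $Z_H$ vanishes). -/

import Mathlib

open scoped Kronecker

noncomputable section

/-- A finite graph, possibly with loops and multiple edges, given by its vertices `V` and its
arcs (oriented edges) `D`: an unoriented edge is a pair `{e, inv e}` of distinct mutually inverse
arcs, so that a graph with `m` edges has `2 * m` arcs. Finiteness is put on `V` and `D`. -/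
structure ArcGraph (V D : Type*) where
  /-- the origin `o(e)` -/
  o : D → V
  /-- the terminus `t(e)` -/
  t : D → V
  /-- the inverse arc -/
  inv : D → D
  inv_inv : ∀ e, inv (inv e) = e
  inv_ne : ∀ e, inv e ≠ e
  o_inv : ∀ e, o (inv e) = t e
  t_inv : ∀ e, t (inv e) = o e

namespace ArcGraph

/-- There is at least one vertex, and any two vertices are joined by a path of arcs. -/
def Connected {V D : Type*} (G : ArcGraph V D) : Prop :=
  Nonempty V ∧ ∀ u v : V, Relation.ReflTransGen (fun a b => ∃ e, G.o e = a ∧ G.t e = b) u v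

/-- Ordinary voltage assignments `α : D(G) → Γ`. -/
structure Voltage {V D : Type*} (G : ArcGraph V D) (Γ : Type*) [Group Γ] where
  toFun : D → Γ
  map_inv : ∀ e, toFun (G.inv e) = (toFun e)⁻¹

/-- The derived graph `G^α`: the arc `e_g = (e, g)` goes from `(o(e), g)` to `(t(e), g α(e))`, and
its inverse is `(e⁻¹, g α(e))`. -/
def derived {V D Γ : Type*} [Group Γ] (G : ArcGraph V D) (α : G.Voltage Γ) :
    ArcGraph (V × Γ) (D × Γ) where
  o e := (G.o e.1, e.2)
  t e := (G.t e.1, e.2 * α.toFun e.1)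
  inv e := (G.inv e.1, e.2 * α.toFun e.1)
  inv_inv e := by
    simp [G.inv_inv, α.map_inv]
  inv_ne e h := G.inv_ne e.1 (congrArg Prod.fst h)
  o_inv e := by simp [G.o_inv]
  t_inv e := by simp [G.t_inv, α.map_inv]

/-- The data of a Hermitian matrix on a graph: on every arc `f` a modulus `h_f ≥ 0` and a phase
`γ_f ∈ [-π/2, π/2]` with `h_{f⁻¹} = h_f` and `γ_{f⁻¹} = -γ_f`, and at every vertex `u` a real
diagonal entry `H_{uu}`. -/
structure HermitianData {V D : Type*} (G : ArcGraph V D) where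
  h : D → ℝ
  γ : D → ℝ
  diag : V → ℝ
  h_nonneg : ∀ f, 0 ≤ h f
  h_inv : ∀ f, h (G.inv f) = h f
  γ_inv : ∀ f, γ (G.inv f) = -γ f
  γ_mem : ∀ f, γ f ∈ Set.Icc (-(Real.pi / 2)) (Real.pi / 2)

namespace HermitianData

variable {V D : Type*} {G : ArcGraph V D}

/-- The Hermitian matrix `H`. For `u ≠ v` the entry `H_{uv}` is `h_f e^{2iγ_f}` if `f` is the arc
from `u` to `v` (the sum of these numbers if there are several) and `0` if there is none. -/
def matrix [DecidableEq V] [Fintype D] (W : G.HermitianData) : Matrix V V ℂ :=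
  Matrix.of fun u v =>
    if u = v then (W.diag u : ℂ)
    else ∑ f : D with G.o f = u ∧ G.t f = v,
      (W.h f : ℂ) * Complex.exp (2 * Complex.I * (W.γ f : ℂ))

theorem matrix_isHermitian [DecidableEq V] [Fintype D] (W : G.HermitianData) :
    W.matrix.IsHermitian := by
  ext u v
  by_cases huv : u = v
  · subst huv
    simp [matrix]
  · simp only [matrix, Matrix.conjTranspose_apply, Matrix.of_apply, if_neg huv,
      if_neg (Ne.symm huv), star_sum]
    refine Finset.sum_bij' (fun f _ => G.inv f) (fun f _ => G.inv f) ?_ ?_ ?_ ?_ ?_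
    · intro f hf
      simp only [Finset.mem_filter, Finset.mem_univ, true_and] at hf ⊢
      exact ⟨(G.o_inv f).trans hf.2, (G.t_inv f).trans hf.1⟩
    · intro f hf
      simp only [Finset.mem_filter, Finset.mem_univ, true_and] at hf ⊢
      exact ⟨(G.o_inv f).trans hf.2, (G.t_inv f).trans hf.1⟩
    · intro f _
      exact G.inv_inv f
    · intro f _
      exact G.inv_inv f
    · intro f _
      have h2 : (starRingEnd ℂ) 2 = 2 := Complex.conj_ofNat 2
      rw [W.h_inv, W.γ_inv]
      simp [← Complex.exp_conj, h2]

/-- `Γ_u`, the sum of `h_f` over all arcs `f` emanating from `u`. -/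
def vertexSum [DecidableEq V] [Fintype D] (W : G.HermitianData) (u : V) : ℝ :=
  ∑ f : D with G.o f = u, W.h f

/-- The scattering coefficient `σ^{(u)}_{ef}(λ)`. -/
def sigma [DecidableEq V] [Fintype D] [DecidableEq D] (W : G.HermitianData) (lam : ℂ)
    (u : V) (e f : D) : ℂ :=
  Complex.I * (if G.inv e = f then 1 else 0)
    - 2 * (((Real.sqrt (W.h e) : ℝ) : ℂ) * ((Real.sqrt (W.h f) : ℝ) : ℂ)
        / (W.matrix u u - lam - Complex.I * (W.vertexSum u : ℂ)))
      * Complex.exp (Complex.I * ((W.γ f : ℂ) + (W.γ e : ℂ)))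

/-- The bond scattering matrix `U(λ)`. -/
def bondScattering [DecidableEq V] [Fintype D] [DecidableEq D] (W : G.HermitianData) (lam : ℂ) :
    Matrix D D ℂ :=
  Matrix.of fun e f => if G.t e = G.o f then W.sigma lam (G.t e) e f else 0

/-- The matrix `U_g`, the part of `U(λ)` on the rows `e` with `α(e) = g`. -/
def bondScatteringPart [DecidableEq V] [Fintype D] [DecidableEq D] {Γ : Type*} [Group Γ]
    [DecidableEq Γ] (W : G.HermitianData) (α : G.Voltage Γ) (lam : ℂ) (g : Γ) : Matrix D D ℂ :=
  Matrix.of fun e f => if G.t e = G.o f ∧ α.toFun e = g then W.sigma lam (G.t e) e f else 0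

/-- The data `h̃`, `γ̃`, `H̃_{u_g u_g}` induced on the derived graph. -/
def lift {Γ : Type*} [Group Γ] (W : G.HermitianData) (α : G.Voltage Γ) :
    (G.derived α).HermitianData where
  h e := W.h e.1
  γ e := W.γ e.1
  diag u := W.diag u.1
  h_nonneg e := W.h_nonneg e.1
  h_inv e := W.h_inv e.1
  γ_inv e := W.γ_inv e.1
  γ_mem e := W.γ_mem e.1

/-- The `L`-function `Z_H(G, λ, ρ, α)` of a matrix representation `ρ` of degree `d`. -/
def LFunction [DecidableEq V] [Fintype D] [DecidableEq D] {Γ : Type*} [Group Γ] [Fintype Γ]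
    [DecidableEq Γ] (W : G.HermitianData) (lam : ℂ) {d : ℕ}
    (ρ : Γ →* Matrix (Fin d) (Fin d) ℂ) (α : G.Voltage Γ) : ℂ :=
  (Matrix.det (1 - ∑ g : Γ, ρ g ⊗ₖ W.bondScatteringPart α lam g))⁻¹

end HermitianData

end ArcGraph

/-- The representation on `ℂ^d` of a matrix representation of degree `d`. -/
def matrixRep {Γ : Type*} [Group Γ] {d : ℕ} (ρ : Γ →* Matrix (Fin d) (Fin d) ℂ) :
    Representation ℂ Γ (Fin d → ℂ) :=
  (Matrix.toLinAlgEquiv' : Matrix (Fin d) (Fin d) ℂ ≃ₐ[ℂ] _).toMonoidHom.comp ρ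

/-- `ρ` lists all inequivalent irreducible complex representations of `Γ`: each `ρ i` is
irreducible, no two are equivalent, and every irreducible representation is equivalent to one
of them. -/
structure IsCompleteIrreps {Γ : Type*} [Group Γ] {ι : Type*} (d : ι → ℕ)
    (ρ : (i : ι) → Γ →* Matrix (Fin (d i)) (Fin (d i)) ℂ) : Prop where
  irreducible : ∀ i, (matrixRep (ρ i)).IsIrreducible
  inequivalent : ∀ i j, Nonempty ((matrixRep (ρ i)).Equiv (matrixRep (ρ j))) → i = j
  complete : ∀ (n : ℕ) (τ : Γ →* Matrix (Fin n) (Fin n) ℂ), (matrixRep τ).IsIrreducible →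
    ∃ i, Nonempty ((matrixRep τ).Equiv (matrixRep (ρ i)))

end

/-! The bond scattering matrix of the covering has entry `U e f` at `((e, g), (f, g * α e))` and
zeros elsewhere, so it acts on the group coordinate by right translation. Right translation
preserves the span of each row of matrix coefficients of an irreducible `ρ i`. In the basis of all
coefficients the matrix is therefore block diagonal, with `d i` copies of `∑ g, ρ i g ⊗ₖ U_g`
(`bondScattering_lift_mul_coeffMatrix`). The coefficients form a basis: Schur orthogonality gives a
left inverse of `coeffMatrix`, and semisimplicity of the group algebra makes it two-sided. -/

theorem Matrix.det_blockDiagonal'_eq_prod {ι R : Type*} {m : ι → Type*} [CommRing R] [Fintype ι]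
    [DecidableEq ι] [∀ i, Fintype (m i)] [∀ i, DecidableEq (m i)]
    (M : (i : ι) → Matrix (m i) (m i) R) :
    (Matrix.blockDiagonal' M).det = ∏ i, (M i).det := by
  classical
  -- The order is arbitrary; it only serves the determinant formula for block triangular matrices.
  let : LinearOrder ι := LinearOrder.lift' (Fintype.equivFin ι) (Fintype.equivFin ι).injective
  rw [(Matrix.blockTriangular_blockDiagonal' M).det_fintype]
  refine Finset.prod_congr rfl fun i _ => ?_
  rw [← Matrix.det_submatrix_equiv_self (Equiv.sigmaSubtype i).symm]
  congr 1
  ext a b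
  simp [Matrix.toSquareBlock_def, Equiv.sigmaSubtype]

theorem Representation.IsIrreducible.of_equiv {k G V W : Type*} [Monoid G] [Field k]
    [AddCommGroup V] [Module k V] [AddCommGroup W] [Module k W]
    {σ : Representation k G V} {τ : Representation k G W}
    (φ : σ.Equiv τ) (hτ : τ.IsIrreducible) : σ.IsIrreducible := by
  rw [Representation.irreducible_iff_isSimpleModule_asModule] at hτ ⊢
  exact IsSimpleModule.congr (LinearEquiv.ofBijective
    (Representation.IntertwiningMap.equivLinearMapAsModule σ τ φ.toIntertwiningMap)
    φ.toLinearEquiv.bijective)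

theorem Representation.ofModule'_apply {k G M : Type*} [Group G] [Field k]
    [AddCommGroup M] [Module k M] [Module (MonoidAlgebra k G) M]
    [IsScalarTower k (MonoidAlgebra k G) M] (g : G) (m : M) :
    Representation.ofModule' (k := k) (G := G) M g m = MonoidAlgebra.single g (1 : k) • m := rfl

theorem Representation.isIrreducible_ofModule' {k G : Type*} [Group G] [Field k] (M : Type*)
    [AddCommGroup M] [Module k M] [Module (MonoidAlgebra k G) M]
    [IsScalarTower k (MonoidAlgebra k G) M] [IsSimpleModule (MonoidAlgebra k G) M] :
    (Representation.ofModule' (k := k) (G := G) M).IsIrreducible := by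
  rw [Representation.irreducible_iff_isSimpleModule_asModule]
  let σ := Representation.ofModule' (k := k) (G := G) M
  let e : σ.asModule ≃ₗ[MonoidAlgebra k G] M :=
    { σ.asModuleEquiv.toAddEquiv with
      map_smul' := fun r m => by
        change σ.asModuleEquiv (r • m) = r • σ.asModuleEquiv m
        rw [Representation.asModuleEquiv_map_smul]
        induction r using MonoidAlgebra.induction_linear with
        | zero => simp
        | add x y hx hy => simp [add_smul, hx, hy]
        | single g a =>
          rw [Representation.asAlgebraHom_single, LinearMap.smul_apply,
            Representation.ofModule'_apply, ← smul_assoc]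
          simp }
  exact IsSimpleModule.congr e

theorem matrixRep_apply {Γ : Type*} [Group Γ] {d : ℕ} (ρ : Γ →* Matrix (Fin d) (Fin d) ℂ)
    (g : Γ) : matrixRep ρ g = Matrix.toLin' (ρ g) := rfl

/-- The matrix representation afforded by a basis. -/
noncomputable def Representation.toMatrixHom {Γ W : Type*} [Group Γ] [AddCommGroup W]
    [Module ℂ W] {n : ℕ}
    (σ : Representation ℂ Γ W) (b : Module.Basis (Fin n) ℂ W) : Γ →* Matrix (Fin n) (Fin n) ℂ :=
  (LinearMap.toMatrixAlgEquiv b).toMonoidHom.comp σ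

theorem Representation.nonempty_equiv_matrixRep_toMatrixHom {Γ W : Type*} [Group Γ]
    [AddCommGroup W] [Module ℂ W] {n : ℕ} (σ : Representation ℂ Γ W)
    (b : Module.Basis (Fin n) ℂ W) : Nonempty ((matrixRep (σ.toMatrixHom b)).Equiv σ) := by
  refine ⟨(Representation.Equiv.mk b.equivFun fun g => ?_).symm⟩
  ext w i
  change b.repr (σ g w) i = (LinearMap.toMatrix b b (σ g)).mulVec (b.repr w) i
  rw [LinearMap.toMatrix_mulVec_repr]

/-! ### Completeness and orthogonality of matrix coefficients -/

namespace IsCompleteIrreps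

variable {Γ : Type*} [Group Γ] {ι : Type*} {d : ι → ℕ}
  {ρ : (i : ι) → Γ →* Matrix (Fin (d i)) (Fin (d i)) ℂ}

theorem sum_smul_eq_zero_of_isIrreducible [Fintype Γ] (hρ : IsCompleteIrreps d ρ) {v : Γ → ℂ}
    (hv : ∀ i, ∑ g, v g • ρ i g = 0) {W : Type*} [AddCommGroup W] [Module ℂ W]
    [FiniteDimensional ℂ W] (σ : Representation ℂ Γ W) (hσ : σ.IsIrreducible) :
    ∑ g, v g • σ g = 0 := by
  obtain ⟨φ⟩ := σ.nonempty_equiv_matrixRep_toMatrixHom (Module.finBasis ℂ W)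
  obtain ⟨i, ⟨ψ⟩⟩ := hρ.complete _ _ (hσ.of_equiv φ)
  let χ := φ.symm.trans ψ
  ext w
  apply χ.toLinearEquiv.injective
  have h := congrArg (fun M => Matrix.toLin' M (χ w)) (hv i)
  simp only [map_sum, map_smul, map_zero, LinearMap.sum_apply, LinearMap.smul_apply,
    LinearMap.zero_apply] at h ⊢
  rw [← h]
  refine Finset.sum_congr rfl fun g _ => ?_
  congr 1
  exact Representation.IntertwiningMap.isIntertwining _ _ χ.toIntertwiningMap g w

-- The element `∑ g, v g • g` of the group algebra kills every simple module, in particular the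
-- class of `1` modulo any maximal left ideal. It thus lies in the Jacobson radical, which vanishes
-- by Maschke's theorem.
open scoped MonoidAlgebra in
theorem eq_zero_of_sum_smul_eq_zero [Fintype Γ] (hρ : IsCompleteIrreps d ρ) {v : Γ → ℂ}
    (hv : ∀ i, ∑ g, v g • ρ i g = 0) : v = 0 := by
  classical
  set x : ℂ[Γ] := ∑ g, MonoidAlgebra.single g (v g) with hx
  suffices h : x = 0 by
    funext g
    have := congrArg (fun y : ℂ[Γ] => y.coeff g) h
    simpa [hx, Finsupp.finsetSum_apply, Finsupp.single_apply] using this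
  have hJ : x ∈ Module.jacobson ℂ[Γ] ℂ[Γ] := by
    refine Submodule.mem_sInf.2 fun I hI => ?_
    have hs : IsSimpleModule ℂ[Γ] (ℂ[Γ] ⧸ I) := isSimpleModule_iff_isCoatom.2 hI
    have : FiniteDimensional ℂ (ℂ[Γ] ⧸ I) :=
      Module.Finite.of_surjective (I.mkQ.restrictScalars ℂ) I.mkQ_surjective
    have h0 := hρ.sum_smul_eq_zero_of_isIrreducible hv _
      (Representation.isIrreducible_ofModule' (k := ℂ) (G := Γ) (ℂ[Γ] ⧸ I))
    have h1 := congrArg (fun T : Module.End ℂ (ℂ[Γ] ⧸ I) => T (I.mkQ 1)) h0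
    rw [← Submodule.ker_mkQ I, LinearMap.mem_ker, ← mul_one x, ← smul_eq_mul, map_smul]
    simpa [hx, Finset.sum_smul, Representation.ofModule'_apply, ← smul_assoc] using h1
  rwa [IsSemisimpleModule.jacobson_eq_bot, Submodule.mem_bot] at hJ

/-- Schur's averaging operator intertwines `τ` and `σ`. -/
theorem mul_sum_mul_mul [Fintype Γ] {m n : ℕ} (σ : Γ →* Matrix (Fin m) (Fin m) ℂ)
    (τ : Γ →* Matrix (Fin n) (Fin n) ℂ) (E : Matrix (Fin m) (Fin n) ℂ) (h : Γ) :
    σ h * ∑ g, σ g⁻¹ * E * τ g = (∑ g, σ g⁻¹ * E * τ g) * τ h := by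
  rw [Matrix.mul_sum, Matrix.sum_mul]
  refine Fintype.sum_equiv (Equiv.mulRight h⁻¹) _ _ fun g => ?_
  simp [Matrix.mul_assoc, ← map_mul]
  simp [← Matrix.mul_assoc, ← map_mul]

/-- Schur's averaging operator as an intertwining map. -/
noncomputable def schurMap [Fintype Γ] {m n : ℕ} (σ : Γ →* Matrix (Fin m) (Fin m) ℂ)
    (τ : Γ →* Matrix (Fin n) (Fin n) ℂ) (E : Matrix (Fin m) (Fin n) ℂ) :
    (matrixRep τ).IntertwiningMap (matrixRep σ) where
  toLinearMap := Matrix.toLin' (∑ g, σ g⁻¹ * E * τ g)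
  isIntertwining' h := by
    rw [matrixRep_apply, matrixRep_apply, ← Matrix.toLin'_mul, ← Matrix.toLin'_mul,
      mul_sum_mul_mul]

theorem sum_mul_mul_eq_zero [Fintype Γ] (hρ : IsCompleteIrreps d ρ) {i j : ι} (hij : i ≠ j)
    (E : Matrix (Fin (d i)) (Fin (d j)) ℂ) : ∑ g, ρ i g⁻¹ * E * ρ j g = 0 := by
  have := hρ.irreducible i
  have := hρ.irreducible j
  rcases Representation.IsIrreducible.bijective_or_eq_zero (schurMap (ρ i) (ρ j) E) with h | h
  · exact absurd (hρ.inequivalent j i ⟨Representation.IntertwiningMap.ofBijective _ h⟩)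
      hij.symm
  · apply Matrix.toLin'.injective
    rw [map_zero]
    exact congrArg Representation.IntertwiningMap.toLinearMap h

theorem sum_mul_mul_self [Fintype Γ] (hρ : IsCompleteIrreps d ρ) (i : ι)
    (E : Matrix (Fin (d i)) (Fin (d i)) ℂ) :
    ((d i : ℂ) / Fintype.card Γ) • ∑ g, ρ i g⁻¹ * E * ρ i g = E.trace • 1 := by
  have := hρ.irreducible i
  obtain ⟨c, hc⟩ :=
    (Representation.IsIrreducible.algebraMap_intertwiningMap_bijective_of_isAlgClosed
      (ρ := matrixRep (ρ i))).2 (schurMap (ρ i) (ρ i) E)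
  have hM : ∑ g, ρ i g⁻¹ * E * ρ i g = c • 1 := by
    apply Matrix.toLin'.injective
    rw [map_smul, Matrix.toLin'_one]
    exact (congrArg Representation.IntertwiningMap.toLinearMap hc).symm
  -- Traces determine Schur's scalar `c`: each conjugate of `E` has trace `E.trace`.
  have ht : (Fintype.card Γ : ℂ) * E.trace = c * d i := by
    have := congrArg Matrix.trace hM
    rw [Matrix.trace_sum, Matrix.trace_smul, Matrix.trace_one] at this
    simp only [Matrix.trace_mul_cycle (ρ i _), ← map_mul] at this
    simpa using this
  have h0 : (Fintype.card Γ : ℂ) ≠ 0 := Nat.cast_ne_zero.2 Fintype.card_ne_zero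
  rw [hM, smul_smul]
  congr 1
  field_simp
  rw [ht]
  ring

/-- The matrix whose columns are the matrix coefficients `g ↦ ρ i g a b`, tensored with the
identity on `D`. -/
def coeffMatrix (D : Type*) [DecidableEq D]
    (ρ : (i : ι) → Γ →* Matrix (Fin (d i)) (Fin (d i)) ℂ) :
    Matrix (D × Γ) (Σ i, (Fin (d i) × D) × Fin (d i)) ℂ :=
  Matrix.of fun x y => if x.1 = y.2.1.2 then ρ y.1 x.2 y.2.2 y.2.1.1 else 0

/-- The inverse of `coeffMatrix`. -/
noncomputable def coeffMatrixInv (D : Type*) [DecidableEq D] [Fintype Γ]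
    (ρ : (i : ι) → Γ →* Matrix (Fin (d i)) (Fin (d i)) ℂ) :
    Matrix (Σ i, (Fin (d i) × D) × Fin (d i)) (D × Γ) ℂ :=
  Matrix.of fun y x => if y.2.1.2 = x.1 then
    (d y.1 : ℂ) / Fintype.card Γ * ρ y.1 x.2⁻¹ y.2.1.1 y.2.2 else 0

/-- Orthogonality is Schur averaging applied to a matrix unit. -/
theorem sum_coeff_mul_coeff_of_ne [Fintype Γ] (hρ : IsCompleteIrreps d ρ) {i j : ι} (hij : i ≠ j)
    (a b : Fin (d i)) (a' b' : Fin (d j)) : ∑ g, ρ i g⁻¹ b a * ρ j g a' b' = 0 := by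
  have h := congrFun₂ (hρ.sum_mul_mul_eq_zero hij (Matrix.single a a' 1)) b b'
  simpa [Matrix.sum_apply, Matrix.mul_apply, Matrix.single_apply, ite_and] using h

theorem sum_coeff_mul_coeff_self [Fintype Γ] (hρ : IsCompleteIrreps d ρ) (i : ι)
    (a b a' b' : Fin (d i)) :
    (d i : ℂ) / Fintype.card Γ * ∑ g, ρ i g⁻¹ b a * ρ i g a' b' =
      if b = b' ∧ a = a' then 1 else 0 := by
  have h := congrFun₂ (hρ.sum_mul_mul_self i (Matrix.single a a' 1)) b b'
  have ht : (Matrix.single a a' (1 : ℂ)).trace = if a = a' then 1 else 0 := by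
    split_ifs with h
    · subst h; simp
    · simp [h]
  rw [ht] at h
  simpa [Matrix.sum_apply, Matrix.mul_apply, Matrix.single_apply, Matrix.one_apply, ite_and]
    using h

theorem coeffMatrixInv_mul_coeffMatrix {D : Type*} [Fintype D] [DecidableEq D] [Fintype Γ]
    [DecidableEq ι] (hρ : IsCompleteIrreps d ρ) :
    coeffMatrixInv D ρ * coeffMatrix D ρ = 1 := by
  ext ⟨i, ⟨b, e⟩, a⟩ ⟨j, ⟨b', f⟩, a'⟩
  have key : (coeffMatrixInv D ρ * coeffMatrix D ρ) ⟨i, ⟨b, e⟩, a⟩ ⟨j, ⟨b', f⟩, a'⟩ =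
      if e = f then (d i : ℂ) / Fintype.card Γ * ∑ g, ρ i g⁻¹ b a * ρ j g a' b' else 0 := by
    simp [Matrix.mul_apply, coeffMatrixInv, coeffMatrix, Fintype.sum_prod_type, Finset.mul_sum,
      mul_assoc]
  rw [key]
  by_cases hij : i = j
  · subst hij
    rw [hρ.sum_coeff_mul_coeff_self, Matrix.one_apply]
    simp only [Sigma.mk.injEq, heq_eq_eq, true_and, Prod.mk.injEq]
    grind
  · rw [hρ.sum_coeff_mul_coeff_of_ne hij, Matrix.one_apply_ne (by simp [hij])]
    simp

/-- The index types are not known to have equal size, so the left inverse alone does not suffice.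
The defect `X` satisfies `X * coeffMatrix D ρ = 0`: each row of `X`, at fixed `f`, is a function on
`Γ` annihilated by every `ρ i`, hence zero. -/
theorem coeffMatrix_mul_coeffMatrixInv {D : Type*} [Fintype D] [DecidableEq D] [Fintype Γ]
    [DecidableEq Γ] [Fintype ι] (hρ : IsCompleteIrreps d ρ) :
    coeffMatrix D ρ * coeffMatrixInv D ρ = 1 := by
  classical
  have h0 : (coeffMatrix D ρ * coeffMatrixInv D ρ - 1) * coeffMatrix D ρ = 0 := by
    rw [Matrix.sub_mul, Matrix.mul_assoc, hρ.coeffMatrixInv_mul_coeffMatrix]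
    simp
  rw [← sub_eq_zero]
  generalize coeffMatrix D ρ * coeffMatrixInv D ρ - 1 = X at h0
  ext x ⟨f, g⟩
  refine congrFun (hρ.eq_zero_of_sum_smul_eq_zero (v := fun g => X x (f, g)) fun i => ?_) g
  ext a b
  have := congrFun₂ h0 x ⟨i, ⟨b, f⟩, a⟩
  simpa [Matrix.mul_apply, coeffMatrix, Fintype.sum_prod_type, Matrix.sum_apply,
    Finset.sum_comm (s := (Finset.univ : Finset D))] using this

end IsCompleteIrreps

/-! ### Block diagonalisation of the covering's scattering matrix -/

namespace ArcGraph.HermitianData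

variable {V D Γ : Type*} [DecidableEq V] [Fintype D] [Group Γ] [Fintype Γ]
  [DecidableEq Γ] {G : ArcGraph V D}

theorem vertexSum_lift (W : G.HermitianData) (α : G.Voltage Γ) (u : V × Γ) :
    (W.lift α).vertexSum u = W.vertexSum u.1 := by
  obtain ⟨u, g⟩ := u
  simp [vertexSum, Finset.sum_filter, Fintype.sum_prod_type, derived, lift, ite_and]

variable [DecidableEq D]

theorem bondScattering_lift (W : G.HermitianData) (α : G.Voltage Γ) (lam : ℂ) (e f : D) (g k : Γ) :
    (W.lift α).bondScattering lam (e, g) (f, k) =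
      if g * α.toFun e = k then W.bondScattering lam e f else 0 := by
  have hd (u : V × Γ) : (W.lift α).matrix u u = W.matrix u.1 u.1 := by simp [matrix, lift]
  simp only [bondScattering, sigma, Matrix.of_apply, vertexSum_lift, hd]
  by_cases hk : g * α.toFun e = k <;> simp [derived, lift, hk]

theorem sum_kronecker_bondScatteringPart_apply (W : G.HermitianData) (α : G.Voltage Γ) (lam : ℂ)
    {n : ℕ} (τ : Γ →* Matrix (Fin n) (Fin n) ℂ) (a b : Fin n) (e f : D) :
    (∑ g, τ g ⊗ₖ W.bondScatteringPart α lam g) (a, e) (b, f) =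
      τ (α.toFun e) a b * W.bondScattering lam e f := by
  simp [Matrix.sum_apply, bondScatteringPart, bondScattering, ite_and]

/-- Expand `ρ i (g * α e) a b` as `∑ c, ρ i g a c * ρ i (α e) c b`. The row index `a` is untouched,
so it labels the `d i` identical blocks. -/
theorem bondScattering_lift_mul_coeffMatrix {ι : Type*} [Fintype ι] [DecidableEq ι]
    (W : G.HermitianData) (α : G.Voltage Γ) (lam : ℂ) {d : ι → ℕ}
    (ρ : (i : ι) → Γ →* Matrix (Fin (d i)) (Fin (d i)) ℂ) :
    (W.lift α).bondScattering lam * IsCompleteIrreps.coeffMatrix D ρ =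
      IsCompleteIrreps.coeffMatrix D ρ * Matrix.blockDiagonal' fun i =>
        Matrix.blockDiagonal fun _ : Fin (d i) =>
          ∑ g, ρ i g ⊗ₖ W.bondScatteringPart α lam g := by
  ext ⟨e, g⟩ ⟨i, ⟨b, f⟩, a⟩
  have hl : ((W.lift α).bondScattering lam * IsCompleteIrreps.coeffMatrix D ρ) (e, g)
      ⟨i, ⟨b, f⟩, a⟩ = W.bondScattering lam e f * ρ i (g * α.toFun e) a b := by
    simp [Matrix.mul_apply, IsCompleteIrreps.coeffMatrix, Fintype.sum_prod_type,
      bondScattering_lift]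
  rw [hl, Matrix.mul_apply, Fintype.sum_sigma, Finset.sum_eq_single i]
  · simp only [Matrix.blockDiagonal'_apply_eq, Matrix.blockDiagonal_apply,
      Fintype.sum_prod_type, sum_kronecker_bondScatteringPart_apply]
    simp [IsCompleteIrreps.coeffMatrix, Matrix.mul_apply, Finset.mul_sum, mul_comm, mul_left_comm]
  · intro j _ hj
    simp [Matrix.blockDiagonal'_apply_ne _ _ _ hj]
  · simp

end ArcGraph.HermitianData

theorem corollary1 {V D Γ ι : Type*} [Fintype V] [DecidableEq V] [Fintype D] [DecidableEq D]
    [Group Γ] [Fintype Γ] [DecidableEq Γ] [Fintype ι]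
    (G : ArcGraph V D) (hG : G.Connected) (W : G.HermitianData) (α : G.Voltage Γ)
    (d : ι → ℕ) (ρ : (i : ι) → Γ →* Matrix (Fin (d i)) (Fin (d i)) ℂ)
    (hρ : IsCompleteIrreps d ρ) (lam : ℂ) :
    Matrix.det (1 - (W.lift α).bondScattering lam)
      = ∏ i, W.LFunction lam (ρ i) α ^ (-(d i : ℤ)) := by
  classical
  set N : Matrix (Σ i, (Fin (d i) × D) × Fin (d i)) _ ℂ := Matrix.blockDiagonal' fun i =>
    Matrix.blockDiagonal fun _ : Fin (d i) => ∑ g, ρ i g ⊗ₖ W.bondScatteringPart α lam g with hN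
  have hU : (W.lift α).bondScattering lam =
      IsCompleteIrreps.coeffMatrix D ρ * (N * IsCompleteIrreps.coeffMatrixInv D ρ) := by
    rw [← Matrix.mul_assoc, ← W.bondScattering_lift_mul_coeffMatrix α lam ρ, Matrix.mul_assoc,
      hρ.coeffMatrix_mul_coeffMatrixInv, Matrix.mul_one]
  have hN' : 1 - N = Matrix.blockDiagonal' fun i => Matrix.blockDiagonal fun _ : Fin (d i) =>
      1 - ∑ g, ρ i g ⊗ₖ W.bondScatteringPart α lam g := by
    rw [hN, ← Matrix.blockDiagonal'_one, ← Matrix.blockDiagonal'_sub]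
    congr 1
    funext i
    rw [Pi.sub_apply, Pi.one_apply, ← Matrix.blockDiagonal_one, ← Matrix.blockDiagonal_sub]
    rfl
  -- The identity `det (1 - A * B) = det (1 - B * A)` holds for rectangular matrices, so no
  -- bijection of index sets is needed.
  rw [hU, Matrix.det_one_sub_mul_comm, Matrix.mul_assoc, hρ.coeffMatrixInv_mul_coeffMatrix,
    Matrix.mul_one, hN', Matrix.det_blockDiagonal'_eq_prod]
  refine Finset.prod_congr rfl fun i _ => ?_
  rw [Matrix.det_blockDiagonal]
  -- Since `0⁻¹ = 0`, `(x⁻¹) ^ (-n) = x ^ n` also when the determinant `x` vanishes.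
  simp [ArcGraph.HermitianData.LFunction]
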